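/- \textbf{Setting.} The state space is $\mathbb R^n$ with the Euclidean norm; $\mathcal P_2$ is the set of Borel probability measures on $\mathbb R^n$ with finite second moment, and $\mathbb W_2(\mu,\nu)=\bigl(\inf_{\pi}\int\|x-y\|^2\,d\pi(x,y)\bigr)^{1/2}$, the infimum being over all couplings $\pi$ of $\mu$ and $\nu$. A fault profile is a function $w:[0,\infty)\to\mathbb R^p$. The faulty closed-loop dynamics are $dX=F_w(X,t)\,dt+\sigma(X,t)\,dW$, $X_0\sim\mu_0\in\mathcal P_2$, with $F_w=f+g\,u_{cl}+\psi w$, where $F_w,\sigma$ are measurable, Lipschitz in $x$ and of linear growth, uniformly in $t$. Fix times $t_0<t_1<\cdots$ in $[0,\infty)$, $k\ge 0$ and $N_r\ge 1$, and let $s=t_k$, $t=t_{k+N_r}$. \emph{Exact operator.} Let $(x_s,x_t)$ be any coupling of the laws of $X_s$ and $X_t$ under the fault $w$, let $z\sim\mathcal N(0,I)$ be independent of it, and let $I_\tau=a_\tau x_s+b_\tau x_t+c_\tau z$, $\tau\in[0,1]$, with $a,b,c\in C^1([0,1])$, $a_0=b_1=1$ and $a_1=b_0=c_0=c_1=0$.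 Let $\mathbf b^w_\tau(x)=\mathbb E[\dot I_\tau\mid I_\tau=x]$, and assume that (the chosen version of) this field generates a measurable two-time flow $\Phi^w_{\tau_0,\tau_1}$, $0\le\tau_0\le\tau_1\le1$. The exact operator is $\mathscr P^w_{s,t}\mu=(\Phi^w_{0,1})_\#\mu$. \emph{Learned operator.} Let $\widehat\Phi^w_{\tau_0,\tau_1}$ be a learned measurable two-time map with $\widehat\Phi^w_{\tau,\tau}=\mathrm{id}$ and $\partial_{\tau_1}\widehat\Phi^w_{\tau_0,\tau_1}(x)=\widehat{\mathbf b}^w_{\tau_1}(\widehat\Phi^w_{\tau_0,\tau_1}(x))$ for $0\le\tau_0\le\tau_1\le1$, where $\widehat{\mathbf b}^w$ and its spatial Jacobian $D\widehat{\mathbf b}^w$ are continuous on $\mathbb R^n\times[0,1]$. The learned operator is $\widehat{\mathscr P}^w_{s,t}\mu=(\widehat\Phi^w_{0,1})_\#\mu$. \emph{Certificate.} Let $M^w$ be a $C^1$ field of symmetric matrices on $\mathbb R^n\times[0,1]$ with $\underline m^wI\preceq M^w\preceq\overline m^wI$, $\underline m^w,\overline m^w>0$, and let $\alpha^w\in\mathbb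 R$. With $\dot M^w$ the total derivative along $\widehat{\mathbf b}^w$ and $[\cdot]_+$ the projection onto the positive semidefinite cone, put \[ \mathcal R^w=\dot M^w+(D\widehat{\mathbf b}^w)^\top M^w+M^wD\widehat{\mathbf b}^w-2\alpha^wM^w,\qquad \varepsilon^w_{\mathrm{ctr}}=\sup_{x,\tau}\bigl\|[\mathcal R^w(x,\tau)]_+\bigr\|_F,\qquad \overline d^w=\sup_{x,\tau}\|\mathbf b^w_\tau(x)-\widehat{\mathbf b}^w_\tau(x)\|, \] the suprema being over $\mathbb R^n\times[0,1]$ and both assumed finite, and \[ \kappa^w=\sqrt{\overline m^w/\underline m^w},\qquad \tilde\alpha^w=\alpha^w+\frac{\varepsilon^w_{\mathrm{ctr}}}{2\underline m^w},\qquad \tilde\delta^w_1=\kappa^w\,\overline d^w\int_0^1e^{\tilde\alpha^w(1-r)}\,dr . \] \textbf{Lemma (recovery target surrogate bound).} Let $w_\star$ be the true fault and $\widehat w$ the identified fault, suppose that $w_\star=\widehat w$, and let the assumptions above hold for $w=w_\star$. Let $\rho_{k|k}\in\mathcal P_2$ be the true and $\widehat\rho_{k|k}\in\mathcal P_2$ the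 estimated filtered law, let $\rho^{\mathrm{fault}}_{k+N_r}=\mathscr P^{w_\star}_{s,t}\rho_{k|k}$ and $\widehat\rho^{\mathrm{fault}}_{k+N_r|k}=\widehat{\mathscr P}^{\widehat w}_{s,t}\widehat\rho_{k|k}$, and let $\rho^{\mathrm{fault}}_{\mathrm{GMM}}$ be a finite Gaussian mixture with $\mathbb W_2(\widehat\rho^{\mathrm{fault}}_{k+N_r|k},\rho^{\mathrm{fault}}_{\mathrm{GMM}})\le\varepsilon_f$ for some $\varepsilon_f>0$. Then \[ \mathbb W_2\bigl(\rho^{\mathrm{fault}}_{k+N_r},\rho^{\mathrm{fault}}_{\mathrm{GMM}}\bigr)\le \kappa^{w_\star}e^{\tilde\alpha^{w_\star}}\,\mathbb W_2(\rho_{k|k},\widehat\rho_{k|k})+\tilde\delta_1^{w_\star}+\varepsilon_f . \] In particular, if $\varepsilon_{\mathrm{ctr}}^{w_\star}=0$, the bound holds with $\alpha^{w_\star}$ in place of $\tilde\alpha^{w_\star}$, also in the definition of the bias. -/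

import Mathlib

open MeasureTheory ProbabilityTheory Set
open scoped NNReal ENNReal Matrix

noncomputable section

namespace FaultRecovery

/-- The state space `ℝⁿ` with its Euclidean norm. -/
abbrev E (n : ℕ) : Type := EuclideanSpace ℝ (Fin n)

/-- Matrix-vector product between Euclidean spaces. -/
def mulE {a c : ℕ} (A : Matrix (Fin a) (Fin c) ℝ) (v : E c) : E a :=
  WithLp.toLp 2 (A *ᵥ WithLp.ofLp v)

/-- The Frobenius norm. -/
def frobeniusNorm {a c : ℕ} (A : Matrix (Fin a) (Fin c) ℝ) : ℝ :=
  Real.sqrt (∑ i, ∑ j, A i j ^ 2)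

/-! ### Probability measures and the 2-Wasserstein distance -/

/-- Borel probability measures on `ℝⁿ` with finite second moment. -/
structure IsP2 {n : ℕ} (μ : Measure (E n)) : Prop where
  prob : IsProbabilityMeasure μ
  secondMoment : ∫⁻ x, ‖x‖ₑ ^ 2 ∂μ < ∞

/-- The couplings of `μ` and `ν`: measures on the product with marginals `μ` and `ν`. -/
def couplings {n : ℕ} (μ ν : Measure (E n)) : Set (Measure (E n × E n)) :=
  {π | π.map Prod.fst = μ ∧ π.map Prod.snd = ν}

/-- The 2-Wasserstein distance, with values in `[0, ∞]`; finite on measures satisfying `IsP2`. -/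
def W2 {n : ℕ} (μ ν : Measure (E n)) : ℝ≥0∞ :=
  (⨅ π ∈ couplings μ ν, ∫⁻ z, ‖z.1 - z.2‖ₑ ^ 2 ∂π) ^ (1 / 2 : ℝ)

/-- Finite Gaussian mixtures `∑ i, β i • 𝒩(m i, S i)`. -/
def IsGaussianMixture {n : ℕ} (ν : Measure (E n)) : Prop :=
  ∃ (N : ℕ) (β : Fin N → ℝ) (m : Fin N → E n) (S : Fin N → Matrix (Fin n) (Fin n) ℝ),
    (∀ i, 0 ≤ β i) ∧ ∑ i, β i = 1 ∧ (∀ i, (S i).PosSemidef) ∧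
      ν = ∑ i, ENNReal.ofReal (β i) • multivariateGaussian (m i) (S i)

/-! ### The fault-indexed stochastic dynamics -/

/-- A fault profile `t ↦ w(t) ∈ ℝᵖ`; a constant fault parameter is a constant profile. -/
abbrev Profile (p : ℕ) : Type := ℝ≥0 → E p

/-- Coefficients of the closed-loop control-affine system
`dx = (f + g u_cl + ψ w) dt + σ dW`. -/
structure FaultSystem (n m p q : ℕ) where
  f : E n → ℝ≥0 → E n
  g : E n → ℝ≥0 → Matrix (Fin n) (Fin m) ℝ
  ucl : E n → ℝ≥0 → E m
  ψ : E n → ℝ≥0 → Matrix (Fin n) (Fin p) ℝ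
  σ : E n → ℝ≥0 → Matrix (Fin n) (Fin q) ℝ

variable {n m p q : ℕ}

/-- The closed-loop vector field `F_w = f + g u_cl + ψ w`. -/
def FaultSystem.F (S : FaultSystem n m p q) (w : Profile p) (x : E n) (t : ℝ≥0) : E n :=
  S.f x t + mulE (S.g x t) (S.ucl x t) + mulE (S.ψ x t) (w t)

/-- Measurability, linear growth and Lipschitz continuity of the closed-loop coefficients. -/
structure FaultSystem.IsRegular (S : FaultSystem n m p q) (w : Profile p) : Prop where
  measurable_drift : Measurable fun z : E n × ℝ≥0 => S.F w z.1 z.2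
  measurable_diffusion : ∀ i j, Measurable fun z : E n × ℝ≥0 => S.σ z.1 z.2 i j
  growth : ∃ L₁ : ℝ, 0 < L₁ ∧ ∀ x t,
    ‖S.F w x t‖ ^ 2 + frobeniusNorm (S.σ x t) ^ 2 ≤ L₁ * (1 + ‖x‖ ^ 2)
  lipschitz : ∃ L₂ : ℝ, 0 < L₂ ∧ ∀ x y t,
    ‖S.F w x t - S.F w y t‖ + frobeniusNorm (S.σ x t - S.σ y t) ≤ L₂ * ‖x - y‖

/-- The generator `F_w · ∇φ + ½ ∑ᵢⱼ (σ σᵀ)ᵢⱼ ∂ᵢ∂ⱼ φ` of the stochastic dynamics. -/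
def FaultSystem.generator (S : FaultSystem n m p q) (w : Profile p) (φ : E n → ℝ)
    (x : E n) (t : ℝ≥0) : ℝ :=
  fderiv ℝ φ x (S.F w x t) +
    (1 / 2) * ∑ i, ∑ j, (S.σ x t * (S.σ x t)ᵀ) i j *
      fderiv ℝ (fun y => fderiv ℝ φ y (EuclideanSpace.single j 1)) x (EuclideanSpace.single i 1)

/-- `X` is a weak solution of `dX = F_w dt + σ dW`, `X₀ ∼ μ₀`, in the martingale-problem
formulation. -/
structure FaultSystem.IsSolution (S : FaultSystem n m p q) (w : Profile p)
    (μ₀ : Measure (E n)) {Ω : Type} [MeasurableSpace Ω] (P : Measure Ω)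
    (X : ℝ≥0 → Ω → E n) : Prop where
  measurable : ∀ t, Measurable (X t)
  continuous : ∀ ω, Continuous fun t => X t ω
  initial : P.map (X 0) = μ₀
  martingale : ∀ φ : E n → ℝ, ContDiff ℝ (⊤ : ℕ∞) φ → HasCompactSupport φ →
    Martingale
      (fun (t : ℝ≥0) ω => φ (X t ω) - φ (X 0 ω) -
        ∫ r in (0 : ℝ)..t, S.generator w φ (X r.toNNReal ω) r.toNNReal)
      (Filtration.natural X fun t => (measurable t).stronglyMeasurable) P

/-- `ρ t` is the law at time `t` of the stochastic dynamics with fault `w` started from `μ₀`. -/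
def FaultSystem.IsMarginals (S : FaultSystem n m p q) (w : Profile p)
    (μ₀ : Measure (E n)) (ρ : ℝ≥0 → Measure (E n)) : Prop :=
  ∃ (Ω : Type) (_ : MeasurableSpace Ω) (P : Measure Ω) (X : ℝ≥0 → Ω → E n),
    IsProbabilityMeasure P ∧ S.IsSolution w μ₀ P X ∧ ∀ t, P.map (X t) = ρ t

/-! ### Stochastic interpolants, flows and Perron-Frobenius operators -/

/-- The coefficients of a stochastic interpolant `I_τ = a(τ) x_s + b(τ) x_t + c(τ) z`. -/
structure Schedule where
  a : ℝ → ℝ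
  b : ℝ → ℝ
  c : ℝ → ℝ
  contDiff_a : ContDiffOn ℝ 1 a (Icc 0 1)
  contDiff_b : ContDiffOn ℝ 1 b (Icc 0 1)
  contDiff_c : ContDiffOn ℝ 1 c (Icc 0 1)
  a_zero : a 0 = 1
  a_one : a 1 = 0
  b_zero : b 0 = 0
  b_one : b 1 = 1
  c_zero : c 0 = 0
  c_one : c 1 = 0

/-- The interpolant `I_τ` as a function of the sample `((x_s, x_t), z)`. -/
def Schedule.interpolant (A : Schedule) (τ : ℝ) (ω : (E n × E n) × E n) : E n :=
  A.a τ • ω.1.1 + A.b τ • ω.1.2 + A.c τ • ω.2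

/-- The pathwise velocity of the interpolant. -/
def Schedule.velocity (A : Schedule) (τ : ℝ) (ω : (E n × E n) × E n) : E n :=
  derivWithin A.a (Icc 0 1) τ • ω.1.1 + derivWithin A.b (Icc 0 1) τ • ω.1.2 +
    derivWithin A.c (Icc 0 1) τ • ω.2

/-- `v τ x = 𝔼[İ_τ | I_τ = x]` for `τ ∈ [0, 1]`, where `(x_s, x_t) ∼ π` and `z ∼ 𝒩(0, I)` is
independent of `(x_s, x_t)`. -/
def Schedule.IsConditionalVelocity (A : Schedule) (π : Measure (E n × E n))
    (v : ℝ → E n → E n) : Prop :=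
  ∀ τ ∈ Icc (0 : ℝ) 1, Measurable (v τ) ∧
    (fun ω => v τ (A.interpolant τ ω)) =ᵐ[π.prod (stdGaussian (E n))]
      condExp (MeasurableSpace.comap (A.interpolant (n := n) τ) inferInstance)
        (π.prod (stdGaussian (E n))) (A.velocity τ)

/-- `v` is the exact auxiliary velocity field for the fault `w` and the physical endpoints
`s`, `t`: the conditional interpolant velocity of a coupling of the two marginals of the stochastic
dynamics at times `s` and `t`. -/
def FaultSystem.IsExactField (S : FaultSystem n m p q) (w : Profile p) (μ₀ : Measure (E n))
    (s t : ℝ≥0) (v : ℝ → E n → E n) : Prop :=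
  ∃ (ρ : ℝ≥0 → Measure (E n)) (π : Measure (E n × E n)) (A : Schedule),
    S.IsMarginals w μ₀ ρ ∧ π ∈ couplings (ρ s) (ρ t) ∧ A.IsConditionalVelocity π v

/-- `Φ τ₀ τ₁` (`0 ≤ τ₀ ≤ τ₁ ≤ 1`) is a two-time flow of Borel maps generated by the field `v`:
`Φ τ τ = id` and `∂_{τ₁} Φ τ₀ τ₁ x = v τ₁ (Φ τ₀ τ₁ x)`. -/
structure IsFlow (v : ℝ → E n → E n) (Φ : ℝ → ℝ → E n → E n) : Prop where
  refl : ∀ τ ∈ Icc (0 : ℝ) 1, ∀ x, Φ τ τ x = x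
  ode : ∀ τ₀ ∈ Icc (0 : ℝ) 1, ∀ τ ∈ Icc τ₀ 1, ∀ x,
    HasDerivWithinAt (fun r => Φ τ₀ r x) (v τ (Φ τ₀ τ x)) (Icc τ₀ 1) τ
  measurable : ∀ τ₀ ∈ Icc (0 : ℝ) 1, ∀ τ ∈ Icc τ₀ 1, Measurable (Φ τ₀ τ)

/-- The Perron-Frobenius operator of a flow: pushforward along its terminal map `Φ 0 1`. -/
def perronFrobenius (Φ : ℝ → ℝ → E n → E n) (μ : Measure (E n)) : Measure (E n) :=
  μ.map (Φ 0 1)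

/-! ### Contraction certificate -/

/-- The field `v` and its spatial derivative are continuous on `[0, 1] × ℝⁿ`. -/
structure IsSmoothField (v : ℝ → E n → E n) : Prop where
  continuousOn : ContinuousOn (fun z : ℝ × E n => v z.1 z.2) (Icc 0 1 ×ˢ univ)
  differentiable : ∀ τ ∈ Icc (0 : ℝ) 1, Differentiable ℝ (v τ)
  continuousOn_fderiv :
    ContinuousOn (fun z : ℝ × E n => fderiv ℝ (v z.1) z.2) (Icc 0 1 ×ˢ univ)

/-- `M` is a continuously differentiable matrix field on `ℝⁿ × [0, 1]` with
`lo • I ⪯ M ⪯ hi • I`, `lo, hi > 0`. -/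
structure IsUniformMetric (M : E n → ℝ → Matrix (Fin n) (Fin n) ℝ) (lo hi : ℝ) : Prop where
  lo_pos : 0 < lo
  hi_pos : 0 < hi
  contDiffOn : ∀ i j, ContDiffOn ℝ 1 (fun z : E n × ℝ => M z.1 z.2 i j) (univ ×ˢ Icc 0 1)
  lower : ∀ x, ∀ τ ∈ Icc (0 : ℝ) 1, (M x τ - lo • (1 : Matrix (Fin n) (Fin n) ℝ)).PosSemidef
  upper : ∀ x, ∀ τ ∈ Icc (0 : ℝ) 1, (hi • (1 : Matrix (Fin n) (Fin n) ℝ) - M x τ).PosSemidef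

/-- The total derivative `Ṁ = ∂_τ M + ∑ₖ vₖ ∂ₖ M` of `M` along the field `v`. -/
def metricDot (M : E n → ℝ → Matrix (Fin n) (Fin n) ℝ) (v : ℝ → E n → E n)
    (x : E n) (τ : ℝ) : Matrix (Fin n) (Fin n) ℝ :=
  Matrix.of fun i j =>
    fderivWithin ℝ (fun z : E n × ℝ => M z.1 z.2 i j) (univ ×ˢ Icc 0 1) (x, τ) (v τ x, 1)

/-- The Jacobian matrix `(∂ⱼ vᵢ)ᵢⱼ`. -/
def jacobian (v : E n → E n) (x : E n) : Matrix (Fin n) (Fin n) ℝ :=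
  Matrix.of fun i j => fderiv ℝ v x (EuclideanSpace.single j 1) i

/-- The contraction residual `Ṁ + Dvᵀ M + M Dv - 2 α M`. -/
def contractionResidual (M : E n → ℝ → Matrix (Fin n) (Fin n) ℝ) (α : ℝ)
    (v : ℝ → E n → E n) (x : E n) (τ : ℝ) : Matrix (Fin n) (Fin n) ℝ :=
  metricDot M v x τ + (jacobian (v τ) x)ᵀ * M x τ + M x τ * jacobian (v τ) x - (2 * α) • M x τ

/-- The projection `[A]₊` of a symmetric matrix onto the positive semidefinite cone: the negative
eigenvalues are replaced by `0`. -/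
def psdPart (A : Matrix (Fin n) (Fin n) ℝ) : Matrix (Fin n) (Fin n) ℝ :=
  cfc (fun r : ℝ => max r 0) A

/-- The size `‖[R]₊‖_F` of the positive part of the contraction residual. -/
def residualSize (M : E n → ℝ → Matrix (Fin n) (Fin n) ℝ) (α : ℝ) (v : ℝ → E n → E n)
    (z : E n × Icc (0 : ℝ) 1) : ℝ :=
  frobeniusNorm (psdPart (contractionResidual M α v z.1 z.2))

/-- `ε_ctr = sup ‖[R]₊‖_F` over `ℝⁿ × [0, 1]` (meaningful when the supremum is finite). -/
def epsCtr (M : E n → ℝ → Matrix (Fin n) (Fin n) ℝ) (α : ℝ) (v : ℝ → E n → E n) : ℝ :=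
  ⨆ z, residualSize M α v z

/-- The corrected contraction rate `α̃ = α + ε_ctr / (2 lo)`. -/
def correctedRate (M : E n → ℝ → Matrix (Fin n) (Fin n) ℝ) (α lo : ℝ)
    (v : ℝ → E n → E n) : ℝ :=
  α + epsCtr M α v / (2 * lo)

/-- The size of the perturbation `v - v'`. -/
def fieldError (v v' : ℝ → E n → E n) (z : E n × Icc (0 : ℝ) 1) : ℝ :=
  ‖v z.2 z.1 - v' z.2 z.1‖

/-- `d̄ = sup ‖v - v'‖` over `ℝⁿ × [0, 1]` (meaningful when the supremum is finite). -/
def dBar (v v' : ℝ → E n → E n) : ℝ := ⨆ z, fieldError v v' z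

/-- `κ = √(hi / lo)`. -/
def kappa (lo hi : ℝ) : ℝ := Real.sqrt (hi / lo)

/-- The terminal bias `δ₁ = κ d̄ ∫₀¹ e^{a (1 - r)} dr` for the rate `a`. -/
def terminalBias (κ d a : ℝ) : ℝ := κ * d * ∫ r in (0 : ℝ)..1, Real.exp (a * (1 - r))

end FaultRecovery

end

/-!
Both flows start from laws on `ℝⁿ`, so it suffices to compare them pathwise: any coupling of the
filtered laws is pushed forward by the pair of terminal maps, Minkowski's inequality in `L²` turns
`‖Φ x - Φ̂ y‖ ≤ κ e^a ‖x - y‖ + δ₁` into a bound on `W2` (`W2_map_le`), and the mixture error enters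
through the triangle inequality for `W2`, which rests on gluing couplings by disintegration
(`exists_gluing`, `W2_triangle`).

The corrected rate `a` is a rate of contraction of the learned field in the metric `M`, because the
positive part of the residual is at most `(ε / lo) M` (`contractsAtRate_correctedRate`).
For two nearby learned trajectories `p`, `q` with difference `e`, the function `eᵀ M(p(τ), τ) e`
satisfies a differential inequality with rate `2 (a + η)`, where `η` comes from the linearization
error (`ContractsAtRate.exists_local_estimate`). So the learned map from time `r` to time `1` is
locally Lipschitz at every point with a constant arbitrarily close to `κ e^{a (1 - r)}`. Applied
along a segment, a mean value inequality makes the constant global (`IsFlow.norm_sub_le`). Neither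
differentiability of the flow in its initial value nor a Riemannian distance is needed, since the
constants at the two ends of the trajectory, `hi` and `lo`, only enter through `κ`.

For the bias, fix an exact trajectory `x` and restart the learned flow from `x r` at time `r`. The
endpoint `Φ̂_{r,1}(x r)` interpolates between the learned and the exact endpoint as `r` runs from
`0` to `1`. Its right slope at `r` is at most `κ e^{a (1 - r)}` times the field error, and integrating
over `r` gives the bias (`IsFlow.norm_sub_le_terminalBias`).
-/

namespace FaultRecovery

open Filter Topology

/-! ### Quadratic forms and the Frobenius norm -/

lemma frobeniusNorm_nonneg {a c : ℕ} (A : Matrix (Fin a) (Fin c) ℝ) : 0 ≤ frobeniusNorm A :=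
  Real.sqrt_nonneg _

lemma abs_dotProduct_mulVec_le {n : ℕ} (A : Matrix (Fin n) (Fin n) ℝ) (x y : E n) :
    |x.ofLp ⬝ᵥ A *ᵥ y.ofLp| ≤ frobeniusNorm A * (‖x‖ * ‖y‖) := by
  have h := Finset.sum_mul_sq_le_sq_mul_sq (Finset.univ : Finset (Fin n × Fin n))
    (fun k => A k.1 k.2) (fun k => x k.1 * y k.2)
  have h1 : ∑ k : Fin n × Fin n, A k.1 k.2 * (x k.1 * y k.2) = x.ofLp ⬝ᵥ A *ᵥ y.ofLp := by
    simp only [Fintype.sum_prod_type, dotProduct, Matrix.mulVec, Finset.mul_sum]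
    exact Finset.sum_congr rfl fun i _ => Finset.sum_congr rfl fun j _ => by ring
  have h2 : ∑ k : Fin n × Fin n, (x k.1 * y k.2) ^ 2 = (‖x‖ * ‖y‖) ^ 2 := by
    simp only [mul_pow, EuclideanSpace.real_norm_sq_eq, Fintype.sum_prod_type, Finset.sum_mul_sum]
  have h3 : ∑ k : Fin n × Fin n, A k.1 k.2 ^ 2 = frobeniusNorm A ^ 2 := by
    rw [frobeniusNorm, Real.sq_sqrt (by positivity), Fintype.sum_prod_type]
  rw [h1, h2, h3, ← mul_pow] at h
  exact abs_le_of_sq_le_sq h (mul_nonneg (frobeniusNorm_nonneg A) (by positivity))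

lemma dotProduct_self_eq_norm_sq {n : ℕ} (x : E n) : x.ofLp ⬝ᵥ x.ofLp = ‖x‖ ^ 2 := by
  rw [EuclideanSpace.real_norm_sq_eq]
  simp only [dotProduct, sq]

/-- The quadratic form of a symmetric matrix is bounded by the size of its positive part, because
`r ≤ max r 0` on the spectrum. -/
lemma dotProduct_mulVec_le_psdPart {n : ℕ} {A : Matrix (Fin n) (Fin n) ℝ} (hA : A.IsHermitian)
    (x : E n) : x.ofLp ⬝ᵥ A *ᵥ x.ofLp ≤ frobeniusNorm (psdPart A) * ‖x‖ ^ 2 := by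
  have hle : (psdPart A - A).PosSemidef := by
    open scoped MatrixOrder in
    have hsa : IsSelfAdjoint A := hA
    have h : cfc (fun r : ℝ => r) A ≤ cfc (fun r : ℝ => max r 0) A :=
      cfc_mono (fun r _ => le_max_left r 0)
    rw [cfc_id' ℝ A] at h
    exact h
  have h := hle.dotProduct_mulVec_nonneg x.ofLp
  simp only [star_trivial, Matrix.sub_mulVec, dotProduct_sub, sub_nonneg] at h
  calc _ ≤ _ := h
    _ ≤ _ := le_abs_self _
    _ ≤ _ := abs_dotProduct_mulVec_le _ x x
    _ = _ := by rw [sq]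

variable {n : ℕ} {M : E n → ℝ → Matrix (Fin n) (Fin n) ℝ} {lo hi : ℝ}

namespace IsUniformMetric

lemma isHermitian (hM : IsUniformMetric M lo hi) {x : E n} {τ : ℝ} (hτ : τ ∈ Icc (0 : ℝ) 1) :
    (M x τ).IsHermitian := by
  have h1 : (lo • (1 : Matrix (Fin n) (Fin n) ℝ)).IsHermitian := by
    rw [Matrix.IsHermitian, Matrix.conjTranspose_smul, Matrix.conjTranspose_one, star_trivial]
  simpa using (hM.lower x τ hτ).isHermitian.add h1

lemma mul_norm_sq_le (hM : IsUniformMetric M lo hi) (x : E n) {τ : ℝ} (hτ : τ ∈ Icc (0 : ℝ) 1)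
    (e : E n) : lo * ‖e‖ ^ 2 ≤ e.ofLp ⬝ᵥ M x τ *ᵥ e.ofLp := by
  have h := (hM.lower x τ hτ).dotProduct_mulVec_nonneg e.ofLp
  simpa [Matrix.sub_mulVec, Matrix.smul_mulVec, dotProduct_self_eq_norm_sq] using h

lemma le_mul_norm_sq (hM : IsUniformMetric M lo hi) (x : E n) {τ : ℝ} (hτ : τ ∈ Icc (0 : ℝ) 1)
    (e : E n) : e.ofLp ⬝ᵥ M x τ *ᵥ e.ofLp ≤ hi * ‖e‖ ^ 2 := by
  have h := (hM.upper x τ hτ).dotProduct_mulVec_nonneg e.ofLp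
  simpa [Matrix.sub_mulVec, Matrix.smul_mulVec, dotProduct_self_eq_norm_sq] using h

lemma continuousOn (hM : IsUniformMetric M lo hi) :
    ContinuousOn (fun z : E n × ℝ => M z.1 z.2) (univ ×ˢ Icc 0 1) :=
  continuousOn_pi.2 fun i => continuousOn_pi.2 fun j => (hM.contDiffOn i j).continuousOn

end IsUniformMetric

/-! ### The contraction condition -/

/-- `M` contracts at rate `a` along `v`: the differential inequality
`Ṁ + Dvᵀ M + M Dv ⪯ 2 a M` holds as an inequality of quadratic forms on `ℝⁿ × [0, 1]`. -/
def ContractsAtRate (M : E n → ℝ → Matrix (Fin n) (Fin n) ℝ) (v : ℝ → E n → E n) (a : ℝ) : Prop :=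
  ∀ x, ∀ τ ∈ Icc (0 : ℝ) 1, ∀ e : E n,
    e.ofLp ⬝ᵥ (metricDot M v x τ + (jacobian (v τ) x)ᵀ * M x τ + M x τ * jacobian (v τ) x) *ᵥ e.ofLp
      ≤ 2 * a * (e.ofLp ⬝ᵥ M x τ *ᵥ e.ofLp)

lemma IsUniformMetric.contractionResidual_isHermitian (hM : IsUniformMetric M lo hi) (α : ℝ)
    (v : ℝ → E n → E n) (x : E n) {τ : ℝ} (hτ : τ ∈ Icc (0 : ℝ) 1) :
    (contractionResidual M α v x τ).IsHermitian := by
  have hMT : ∀ y, ∀ r ∈ Icc (0 : ℝ) 1, (M y r)ᵀ = M y r := fun y r hr => by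
    have := hM.isHermitian (x := y) hr
    rwa [Matrix.IsHermitian, Matrix.conjTranspose_eq_transpose_of_trivial] at this
  have hdot : (metricDot M v x τ)ᵀ = metricDot M v x τ := by
    ext i j
    simp only [metricDot, Matrix.transpose_apply, Matrix.of_apply]
    have hij : EqOn (fun z : E n × ℝ => M z.1 z.2 j i) (fun z => M z.1 z.2 i j)
        (univ ×ˢ Icc 0 1) := fun z hz => congrFun (congrFun (hMT z.1 z.2 hz.2) i) j
    rw [fderivWithin_congr hij (hij ⟨mem_univ _, hτ⟩)]
  rw [Matrix.IsHermitian, Matrix.conjTranspose_eq_transpose_of_trivial, contractionResidual]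
  simp only [Matrix.transpose_sub, Matrix.transpose_add, Matrix.transpose_mul,
    Matrix.transpose_smul, Matrix.transpose_transpose, hMT x τ hτ, hdot]
  abel

/-- A bounded residual is absorbed into the rate: `eᵀ R e ≤ ε ‖e‖² ≤ (ε / lo) eᵀ M e`. -/
lemma contractsAtRate_correctedRate {v : ℝ → E n → E n} {α : ℝ} (hM : IsUniformMetric M lo hi)
    (hres : BddAbove (Set.range (residualSize M α v))) :
    ContractsAtRate M v (correctedRate M α lo v) := by
  intro x τ hτ e
  have h1 := dotProduct_mulVec_le_psdPart (hM.contractionResidual_isHermitian α v x hτ) e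
  have h2 : frobeniusNorm (psdPart (contractionResidual M α v x τ)) ≤ epsCtr M α v :=
    le_ciSup hres (x, (⟨τ, hτ⟩ : Icc (0 : ℝ) 1))
  have hε : 0 ≤ epsCtr M α v := (frobeniusNorm_nonneg _).trans h2
  have h3 := hM.mul_norm_sq_le x hτ e
  have h4 : epsCtr M α v * ‖e‖ ^ 2 ≤ epsCtr M α v / lo * (e.ofLp ⬝ᵥ M x τ *ᵥ e.ofLp) := by
    rw [div_mul_eq_mul_div, le_div_iff₀ hM.lo_pos, mul_assoc, mul_comm _ lo]
    exact mul_le_mul_of_nonneg_left h3 hε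
  have h5 := mul_le_mul_of_nonneg_right h2 (sq_nonneg ‖e‖)
  have h6 : 2 * correctedRate M α lo v = 2 * α + epsCtr M α v / lo := by
    rw [correctedRate]; field_simp
  have h7 : e.ofLp ⬝ᵥ contractionResidual M α v x τ *ᵥ e.ofLp = e.ofLp ⬝ᵥ (metricDot M v x τ +
      (jacobian (v τ) x)ᵀ * M x τ + M x τ * jacobian (v τ) x) *ᵥ e.ofLp -
        2 * α * (e.ofLp ⬝ᵥ M x τ *ᵥ e.ofLp) := by
    rw [contractionResidual, Matrix.sub_mulVec, dotProduct_sub, Matrix.smul_mulVec,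
      dotProduct_smul, smul_eq_mul]
  rw [h6, add_mul]
  linarith

/-! ### Infinitesimal contraction along pairs of trajectories -/

lemma mulVec_jacobian (v : E n → E n) (x e : E n) :
    jacobian v x *ᵥ e.ofLp = (fderiv ℝ v x e).ofLp := by
  ext i
  have he : e = ∑ j, e j • EuclideanSpace.single j (1 : ℝ) := by
    ext k; simp [Finset.sum_apply, Pi.single_apply]
  conv_rhs => rw [he, map_sum]
  simp [jacobian, Matrix.mulVec, dotProduct, mul_comm]

/-- Derivative of the squared `M`-distance `eᵀ M(p(τ), τ) e` for a trajectory `p` of `v`. -/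
lemma hasDerivWithinAt_metric {v : ℝ → E n → E n} (hM : IsUniformMetric M lo hi) {r τ : ℝ}
    (hr : 0 ≤ r) (hτ : τ ∈ Icc r 1) {p e : ℝ → E n} {e' : E n}
    (hp : HasDerivWithinAt p (v τ (p τ)) (Icc r 1) τ) (he : HasDerivWithinAt e e' (Icc r 1) τ) :
    HasDerivWithinAt (fun s => (e s).ofLp ⬝ᵥ M (p s) s *ᵥ (e s).ofLp)
      (e'.ofLp ⬝ᵥ M (p τ) τ *ᵥ (e τ).ofLp + (e τ).ofLp ⬝ᵥ metricDot M v (p τ) τ *ᵥ (e τ).ofLp +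
        (e τ).ofLp ⬝ᵥ M (p τ) τ *ᵥ e'.ofLp) (Icc r 1) τ := by
  have hc : ∀ i, HasDerivWithinAt (fun s => e s i) (e' i) (Icc r 1) τ := fun i =>
    (EuclideanSpace.proj (𝕜 := ℝ) i).hasFDerivAt.comp_hasDerivWithinAt τ he
  have hmaps : MapsTo (fun s => (p s, s)) (Icc r 1) (univ ×ˢ Icc (0 : ℝ) 1) :=
    fun s hs => ⟨mem_univ _, hr.trans hs.1, hs.2⟩
  have hcurve : HasDerivWithinAt (fun s => (p s, s)) (v τ (p τ), (1 : ℝ)) (Icc r 1) τ :=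
    hp.prodMk (hasDerivWithinAt_id τ (Icc r 1))
  have hMd : ∀ i j, HasDerivWithinAt (fun s => M (p s) s i j) (metricDot M v (p τ) τ i j)
      (Icc r 1) τ := fun i j =>
    HasFDerivWithinAt.comp_hasDerivWithinAt (f := fun s => (p s, s)) τ
      (((hM.contDiffOn i j).differentiableOn one_ne_zero) (p τ, τ) (hmaps hτ)).hasFDerivWithinAt
      hcurve hmaps
  have hsum := HasDerivWithinAt.fun_sum (u := Finset.univ) fun i _ =>
    (hc i).mul (HasDerivWithinAt.fun_sum (u := Finset.univ) fun j _ => (hMd i j).mul (hc j))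
  refine hsum.congr_deriv ?_
  simp only [dotProduct, Matrix.mulVec, Finset.mul_sum, ← Finset.sum_add_distrib, mul_add]
  exact Finset.sum_congr rfl fun i _ => Finset.sum_congr rfl fun j _ => by
    simp only [Pi.mul_apply]; ring

/-- `p` is a trajectory of the field `v` on `[r, 1]`. -/
def IsTrajectory (v : ℝ → E n → E n) (r : ℝ) (p : ℝ → E n) : Prop :=
  ∀ τ ∈ Icc r 1, HasDerivWithinAt p (v τ (p τ)) (Icc r 1) τ

lemma IsTrajectory.continuousOn {v : ℝ → E n → E n} {r : ℝ} {p : ℝ → E n}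
    (hp : IsTrajectory v r p) : ContinuousOn p (Icc r 1) :=
  fun τ hτ => (hp τ hτ).continuousWithinAt

lemma IsTrajectory.mono {v : ℝ → E n → E n} {r r' : ℝ} {p : ℝ → E n}
    (hp : IsTrajectory v r p) (h : r ≤ r') : IsTrajectory v r' p :=
  fun τ hτ => (hp τ ⟨h.trans hτ.1, hτ.2⟩).mono (Icc_subset_Icc_left h)

lemma _root_.HasDerivWithinAt.Ici_of_Icc {F : Type*} [NormedAddCommGroup F] [NormedSpace ℝ F]
    {f : ℝ → F} {f' : F} {a b x : ℝ} (h : HasDerivWithinAt f f' (Icc a b) x)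
    (hx : x ∈ Ico a b) : HasDerivWithinAt f f' (Ici x) x :=
  h.mono_of_mem_nhdsWithin (Icc_mem_nhdsGE_of_mem hx)

/-- First-order expansion of the field around a trajectory, uniform in time. -/
lemma IsSmoothField.exists_linearization {v : ℝ → E n → E n} (hv : IsSmoothField v) {r : ℝ}
    (hr : 0 ≤ r) {p : ℝ → E n} (hp : ContinuousOn p (Icc r 1)) {ω : ℝ} (hω : 0 < ω) :
    ∃ δ > 0, ∀ τ ∈ Icc r 1, ∀ y, ‖y - p τ‖ < δ →
      ‖v τ y - v τ (p τ) - fderiv ℝ (v τ) (p τ) (y - p τ)‖ ≤ ω * ‖y - p τ‖ := by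
  have hcont : ContinuousOn (fun z : ℝ × E n => fderiv ℝ (v z.1) (p z.1 + z.2))
      (Icc r 1 ×ˢ Metric.closedBall 0 1) := by
    refine hv.continuousOn_fderiv.comp (f := fun z : ℝ × E n => (z.1, p z.1 + z.2))
      (continuousOn_fst.prodMk ((hp.comp continuousOn_fst fun z hz => hz.1).add continuousOn_snd))
      fun z hz => ⟨⟨hr.trans hz.1.1, hz.1.2⟩, mem_univ _⟩
  have huc := (isCompact_Icc.prod
    (isCompact_closedBall (0 : E n) 1)).uniformContinuousOn_of_continuous hcont
  obtain ⟨δ, hδ, hd⟩ := Metric.uniformContinuousOn_iff.1 huc ω hω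
  refine ⟨min δ 1, lt_min hδ one_pos, fun τ hτ y hy => ?_⟩
  have hτ' : τ ∈ Icc (0 : ℝ) 1 := ⟨hr.trans hτ.1, hτ.2⟩
  refine Convex.norm_image_sub_le_of_norm_fderiv_le' (s := Metric.ball (p τ) (min δ 1))
    (fun x _ => hv.differentiable τ hτ' x) (fun x hx => ?_) (convex_ball _ _)
    (Metric.mem_ball_self (lt_min hδ one_pos)) (by rwa [Metric.mem_ball, dist_eq_norm])
  rw [Metric.mem_ball, dist_eq_norm] at hx
  have h := hd (τ, x - p τ) ⟨hτ, by simpa using (hx.trans_le (min_le_right _ _)).le⟩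
    (τ, 0) ⟨hτ, by simp⟩ (by simpa [Prod.dist_eq, hδ] using hx.trans_le (min_le_left _ _))
  rw [dist_eq_norm] at h
  simpa using h.le

lemma norm_le_kappa_mul (hlo : 0 < lo) (hhi : 0 < hi) {x s N : ℝ} (hs : 0 ≤ s)
    (h : lo * N ^ 2 ≤ hi * s ^ 2 * Real.exp (2 * x)) : N ≤ kappa lo hi * Real.exp x * s := by
  refine le_of_sq_le_sq ?_ (by unfold kappa; positivity)
  rw [mul_pow, mul_pow, kappa, Real.sq_sqrt (by positivity), ← Real.exp_nat_mul, div_mul_eq_mul_div,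
    div_mul_eq_mul_div, le_div_iff₀ hlo]
  push_cast
  linarith

/-- Near a fixed trajectory `p`, trajectories approach or separate from `p` at exponential rate
`a + η`. The squared `M(p(τ), τ)`-distance `V` satisfies `V' ≤ (2 a + η) V` as long as the
linearized field dominates, and the barrier `hi s² e^{2 (a + η) (τ - r)}` keeps the pair in that regime. -/
lemma ContractsAtRate.exists_local_estimate {v : ℝ → E n → E n} {a : ℝ}
    (hM : IsUniformMetric M lo hi) (hv : IsSmoothField v) (ha : ContractsAtRate M v a) {r : ℝ}
    (hr : 0 ≤ r) (hr1 : r ≤ 1) {p : ℝ → E n} (hp : IsTrajectory v r p) {η : ℝ} (hη : 0 < η) :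
    ∃ δ > 0, ∀ s, 0 < s → s ≤ δ → ∀ q, IsTrajectory v r q → ‖q r - p r‖ ≤ s →
      ∀ τ ∈ Icc r 1, ‖q τ - p τ‖ ≤ kappa lo hi * Real.exp ((a + η) * (τ - r)) * s := by
  have hlo := hM.lo_pos
  have hhi := hM.hi_pos
  have hκ : 0 < kappa lo hi := Real.sqrt_pos.2 (div_pos hhi hlo)
  have hI : ∀ τ ∈ Icc r 1, τ ∈ Icc (0 : ℝ) 1 := fun τ hτ => ⟨hr.trans hτ.1, hτ.2⟩
  obtain ⟨C, hC0, hC⟩ : ∃ C > 0, ∀ τ ∈ Icc r 1, frobeniusNorm (M (p τ) τ) ≤ C := by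
    have hMp : ContinuousOn (fun τ => M (p τ) τ) (Icc r 1) :=
      hM.continuousOn.comp (f := fun τ => (p τ, τ)) (hp.continuousOn.prodMk continuousOn_id)
        fun τ hτ => ⟨mem_univ _, hI τ hτ⟩
    have hF : Continuous fun A : Matrix (Fin n) (Fin n) ℝ => frobeniusNorm A := by
      unfold frobeniusNorm; fun_prop
    obtain ⟨C, hC⟩ := isCompact_Icc.bddAbove_image (hF.comp_continuousOn hMp)
    exact ⟨max C 1, by positivity, fun τ hτ =>
      (hC (mem_image_of_mem _ hτ)).trans (le_max_left _ _)⟩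
  obtain ⟨δ₀, hδ₀, hlin⟩ := hv.exists_linearization hr hp.continuousOn
    (ω := η * lo / (2 * C)) (by positivity)
  set K := kappa lo hi * Real.exp |a + η| with hK
  have hK0 : 0 < K := by positivity
  refine ⟨δ₀ / (2 * K), by positivity, fun s hs hsδ q hq hqs => ?_⟩
  set V : ℝ → ℝ := fun τ => (q τ - p τ).ofLp ⬝ᵥ M (p τ) τ *ᵥ (q τ - p τ).ofLp with hV
  have hVd : ∀ τ ∈ Icc r 1, HasDerivWithinAt V _ (Icc r 1) τ := fun τ hτ =>
    hasDerivWithinAt_metric hM hr hτ (hp τ hτ) ((hq τ hτ).fun_sub (hp τ hτ))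
  have hVle : ∀ τ ∈ Icc r 1, V τ ≤ hi * s ^ 2 * Real.exp (2 * ((a + η) * (τ - r))) := by
    refine image_le_of_deriv_right_lt_deriv_boundary' (fun τ hτ => (hVd τ hτ).continuousWithinAt)
      (fun τ hτ => (hVd τ (Ico_subset_Icc_self hτ)).Ici_of_Icc hτ)
      (B' := fun τ => hi * s ^ 2 * (Real.exp (2 * ((a + η) * (τ - r))) * (2 * (a + η)))) ?_
      (by fun_prop) (fun τ _ => ?_) ?_
    · calc V r ≤ hi * ‖q r - p r‖ ^ 2 := hM.le_mul_norm_sq _ (hI r ⟨le_rfl, hr1⟩) _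
        _ ≤ hi * s ^ 2 * Real.exp (2 * ((a + η) * (r - r))) := by
          simp only [sub_self, mul_zero, Real.exp_zero, mul_one]
          gcongr
    · have : HasDerivAt (fun τ => 2 * ((a + η) * (τ - r))) (2 * (a + η)) τ := by
        simpa using (((hasDerivAt_id τ).sub_const r).const_mul (a + η)).const_mul 2
      exact (this.exp.const_mul _).hasDerivWithinAt
    · intro τ hτ hVB
      have hτI := Ico_subset_Icc_self hτ
      set e := q τ - p τ with he
      have hlow : lo * ‖e‖ ^ 2 ≤ V τ := hM.mul_norm_sq_le _ (hI τ hτI) e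
      -- on the barrier the distance is still in the range of the linearization
      have hclose : ‖e‖ < δ₀ := by
        have h1 := norm_le_kappa_mul hlo hhi hs.le (hlow.trans_eq hVB)
        have h2 : (a + η) * (τ - r) ≤ |a + η| := by
          calc (a + η) * (τ - r) ≤ |a + η| * (τ - r) :=
                mul_le_mul_of_nonneg_right (le_abs_self _) (sub_nonneg.2 hτ.1)
            _ ≤ |a + η| * 1 := mul_le_mul_of_nonneg_left (by linarith [hτ.2]) (abs_nonneg _)
            _ = _ := mul_one _
        calc ‖e‖ ≤ kappa lo hi * Real.exp ((a + η) * (τ - r)) * s := h1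
          _ ≤ K * (δ₀ / (2 * K)) := by rw [hK]; gcongr
          _ = δ₀ / 2 := by field_simp
          _ < δ₀ := half_lt_self hδ₀
      set ρ := v τ (q τ) - v τ (p τ) - fderiv ℝ (v τ) (p τ) e with hρ
      have hρle : ‖ρ‖ ≤ η * lo / (2 * C) * ‖e‖ := hlin τ hτI _ hclose
      have he' : (v τ (q τ) - v τ (p τ)).ofLp = jacobian (v τ) (p τ) *ᵥ e.ofLp + ρ.ofLp := by
        rw [mulVec_jacobian, ← WithLp.ofLp_add, hρ]; congr 1; abel
      have hprod : frobeniusNorm (M (p τ) τ) * (‖ρ‖ * ‖e‖) ≤ η / 2 * V τ := by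
        calc frobeniusNorm (M (p τ) τ) * (‖ρ‖ * ‖e‖)
            ≤ C * (η * lo / (2 * C) * ‖e‖ * ‖e‖) := by gcongr; exact hC τ hτI
          _ = η / 2 * (lo * ‖e‖ ^ 2) := by field_simp
          _ ≤ η / 2 * V τ := by gcongr
      have h1 := (le_abs_self _).trans (abs_dotProduct_mulVec_le (M (p τ) τ) ρ e)
      have h2 := (le_abs_self _).trans (abs_dotProduct_mulVec_le (M (p τ) τ) e ρ)
      rw [mul_comm ‖e‖] at h2
      have h3 := ha (p τ) τ (hI τ hτI) e
      have hVpos : 0 < V τ := by rw [hVB]; positivity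
      have h4 : 0 < η * V τ := mul_pos hη hVpos
      change _ ≤ 2 * a * V τ at h3
      have hB' : hi * s ^ 2 * (Real.exp (2 * ((a + η) * (τ - r))) * (2 * (a + η))) =
          V τ * (2 * (a + η)) := by rw [hVB]; ring
      simp only [Matrix.add_mulVec, dotProduct_add, ← Matrix.mulVec_mulVec] at h3
      rw [Matrix.dotProduct_mulVec _ (jacobian (v τ) (p τ))ᵀ, Matrix.vecMul_transpose] at h3
      rw [hB', he', Matrix.mulVec_add, add_dotProduct, dotProduct_add]
      linarith
  intro τ hτ
  exact norm_le_kappa_mul hlo hhi hs.le ((hM.mul_norm_sq_le _ (hI τ hτ) _).trans (hVle τ hτ))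

/-! ### Mean value inequalities from right slopes -/

section MeanValue

variable {F G : Type*} [NormedAddCommGroup F] [NormedSpace ℝ F] [NormedAddCommGroup G]

lemma norm_sub_le_of_right_slope_le {g : ℝ → G} {B B' : ℝ → ℝ} {a b : ℝ} (hab : a ≤ b)
    (hg : ContinuousOn g (Icc a b)) (hB : ContinuousOn B (Icc a b))
    (hB' : ∀ x ∈ Ico a b, HasDerivWithinAt B (B' x) (Ici x) x)
    (h : ∀ x ∈ Ico a b, ∀ c, B' x < c → ∀ᶠ z in 𝓝[>] x, ‖g z - g x‖ ≤ c * (z - x)) :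
    ‖g b - g a‖ ≤ B b - B a := by
  refine image_le_of_liminf_slope_right_le_deriv_boundary (f := fun z => ‖g z - g a‖)
    (B := fun z => B z - B a) (hg.sub continuousOn_const).norm (by simp)
    (hB.sub continuousOn_const) (fun x hx => (hB' x hx).sub_const _) (fun x hx r hr => ?_)
    (right_mem_Icc.2 hab)
  refine Eventually.frequently ?_
  filter_upwards [h x hx _ (left_lt_add_div_two.2 hr), self_mem_nhdsWithin] with z hz hxz
  have hxz' : 0 < z - x := sub_pos.2 hxz
  rw [slope_def_field, div_lt_iff₀ hxz']
  calc ‖g z - g a‖ - ‖g x - g a‖ ≤ ‖(g z - g a) - (g x - g a)‖ := norm_sub_norm_le _ _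
    _ = ‖g z - g x‖ := by rw [sub_sub_sub_cancel_right]
    _ ≤ _ := hz
    _ < r * (z - x) := by gcongr; exact add_div_two_lt_right.2 hr

lemma norm_sub_le_of_eventually_le {f : F → G} {C : ℝ}
    (h : ∀ x, ∀ᶠ y in 𝓝 x, ‖f y - f x‖ ≤ C * ‖y - x‖) (x y : F) :
    ‖f y - f x‖ ≤ C * ‖y - x‖ := by
  have hf : Continuous f := by
    refine continuous_iff_continuousAt.2 fun z => ?_
    refine tendsto_iff_norm_sub_tendsto_zero.2 (squeeze_zero' (Eventually.of_forall fun _ =>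
      norm_nonneg _) (h z) ?_)
    have : Continuous fun y => C * ‖y - z‖ := by fun_prop
    simpa using this.tendsto z
  have hγ : Continuous fun σ : ℝ => x + σ • (y - x) := by fun_prop
  have := norm_sub_le_of_right_slope_le (g := fun σ : ℝ => f (x + σ • (y - x)))
    (B := fun σ => C * ‖y - x‖ * σ) (B' := fun _ => C * ‖y - x‖) zero_le_one
    (hf.comp hγ).continuousOn (by fun_prop)
    (fun σ _ => by simpa using ((hasDerivAt_id σ).const_mul (C * ‖y - x‖)).hasDerivWithinAt)
    (fun σ _ c hc => ?_)
  · simpa using this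
  · filter_upwards [(hγ.tendsto σ).eventually (h _) |>.filter_mono nhdsWithin_le_nhds,
      self_mem_nhdsWithin] with z hz hσz
    have hσz' : 0 < z - σ := sub_pos.2 hσz
    rw [add_sub_add_left_eq_sub, ← sub_smul, norm_smul, Real.norm_of_nonneg hσz'.le] at hz
    calc _ ≤ _ := hz
      _ = C * ‖y - x‖ * (z - σ) := by ring
      _ ≤ c * (z - σ) := by gcongr

end MeanValue

/-! ### The learned flow is Lipschitz -/

section Flow

variable {v : ℝ → E n → E n} {Φ : ℝ → ℝ → E n → E n} {a : ℝ}

lemma IsFlow.isTrajectory (hΦ : IsFlow v Φ) {r : ℝ} (hr : r ∈ Icc (0 : ℝ) 1) (x : E n) :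
    IsTrajectory v r fun τ => Φ r τ x :=
  fun τ hτ => hΦ.ode r hr τ hτ x

lemma ContractsAtRate.eq_of_isTrajectory (hM : IsUniformMetric M lo hi) (hv : IsSmoothField v)
    (ha : ContractsAtRate M v a) {r : ℝ} (hr : r ∈ Icc (0 : ℝ) 1) {p q : ℝ → E n}
    (hp : IsTrajectory v r p) (hq : IsTrajectory v r q) (hpq : q r = p r) : q 1 = p 1 := by
  obtain ⟨δ, hδ, h⟩ := ha.exists_local_estimate hM hv hr.1 hr.2 hp one_pos
  have hlim : Tendsto (fun s => kappa lo hi * Real.exp ((a + 1) * (1 - r)) * s) (𝓝[>] 0) (𝓝 0) := by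
    have : Continuous fun s => kappa lo hi * Real.exp ((a + 1) * (1 - r)) * s := by fun_prop
    simpa using (this.tendsto 0).mono_left nhdsWithin_le_nhds
  have hle : ‖q 1 - p 1‖ ≤ 0 := by
    refine ge_of_tendsto hlim ?_
    filter_upwards [Ioc_mem_nhdsGT hδ] with s hs
    exact h s hs.1 hs.2 q hq (by simpa [hpq] using hs.1.le) 1 (right_mem_Icc.2 hr.2)
  exact sub_eq_zero.1 (norm_le_zero_iff.1 hle)

lemma IsFlow.norm_sub_le (hM : IsUniformMetric M lo hi) (hv : IsSmoothField v)
    (ha : ContractsAtRate M v a) (hΦ : IsFlow v Φ) {r : ℝ} (hr : r ∈ Icc (0 : ℝ) 1) (x y : E n) :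
    ‖Φ r 1 y - Φ r 1 x‖ ≤ kappa lo hi * Real.exp (a * (1 - r)) * ‖y - x‖ := by
  have hη : ∀ η > 0, ‖Φ r 1 y - Φ r 1 x‖ ≤
      kappa lo hi * Real.exp ((a + η) * (1 - r)) * ‖y - x‖ := by
    refine fun η hη => norm_sub_le_of_eventually_le (fun x => ?_) x y
    obtain ⟨δ, hδ, h⟩ := ha.exists_local_estimate hM hv hr.1 hr.2 (hΦ.isTrajectory hr x) hη
    filter_upwards [Metric.closedBall_mem_nhds x hδ] with y hy
    rcases eq_or_ne y x with rfl | hyx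
    · simp
    · refine h ‖y - x‖ (norm_pos_iff.2 (sub_ne_zero.2 hyx)) (by rwa [← dist_eq_norm]) _
        (hΦ.isTrajectory hr y) ?_ 1 (right_mem_Icc.2 hr.2)
      simp only [hΦ.refl r hr, le_refl]
  have hlim : Tendsto (fun η => kappa lo hi * Real.exp ((a + η) * (1 - r)) * ‖y - x‖) (𝓝[>] 0)
      (𝓝 (kappa lo hi * Real.exp (a * (1 - r)) * ‖y - x‖)) := by
    have : Continuous fun η => kappa lo hi * Real.exp ((a + η) * (1 - r)) * ‖y - x‖ := by fun_prop
    simpa using (this.tendsto 0).mono_left nhdsWithin_le_nhds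
  exact ge_of_tendsto hlim (by filter_upwards [self_mem_nhdsWithin] with η h using hη η h)

/-! ### Comparison of the exact and the learned flow -/

/-- Replacing the learned trajectory from `x r` by the one from `x r'` changes the endpoint by at
most the local defect `x r' - Φ r r' (x r)`, propagated from `r'` to `1`. -/
lemma IsFlow.norm_restart_sub_le (hM : IsUniformMetric M lo hi) (hv : IsSmoothField v)
    (ha : ContractsAtRate M v a) (hΦ : IsFlow v Φ) {r r' : ℝ} (hr : 0 ≤ r) (hrr' : r ≤ r')
    (hr' : r' ≤ 1) (x : ℝ → E n) :
    ‖Φ r' 1 (x r') - Φ r 1 (x r)‖ ≤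
      kappa lo hi * Real.exp (a * (1 - r')) * ‖x r' - Φ r r' (x r)‖ := by
  have hrI : r ∈ Icc (0 : ℝ) 1 := ⟨hr, hrr'.trans hr'⟩
  have hrI' : r' ∈ Icc (0 : ℝ) 1 := ⟨hr.trans hrr', hr'⟩
  have hsemi : Φ r 1 (x r) = Φ r' 1 (Φ r r' (x r)) :=
    ha.eq_of_isTrajectory hM hv hrI' (hΦ.isTrajectory hrI' _)
      ((hΦ.isTrajectory hrI (x r)).mono hrr') (hΦ.refl r' hrI' _).symm
  rw [hsemi]
  exact hΦ.norm_sub_le hM hv ha hrI' _ _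

/-- Learned trajectories started on a bounded curve have uniformly bounded initial speed. -/
lemma IsFlow.exists_norm_sub_le (hv : IsSmoothField v) (hΦ : IsFlow v Φ) {x : ℝ → E n}
    (hx : ContinuousOn x (Icc 0 1)) :
    ∃ C > 0, ∀ r r', 0 ≤ r → r ≤ r' → r' ≤ 1 → C * (r' - r) ≤ 1 →
      ‖Φ r r' (x r) - x r‖ ≤ C * (r' - r) := by
  obtain ⟨R, hR⟩ := isCompact_Icc.exists_bound_of_continuousOn hx
  obtain ⟨C, hC⟩ := (isCompact_Icc.prod
    (isCompact_closedBall (0 : E n) (R + 1))).exists_bound_of_continuousOn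
    (hv.continuousOn.mono (prod_mono_right (subset_univ _)))
  refine ⟨|C| + 1, by positivity, fun r r' hr hrr' hr' hsmall => ?_⟩
  have hrI : r ∈ Icc (0 : ℝ) 1 := ⟨hr, hrr'.trans hr'⟩
  have htraj := (hΦ.isTrajectory hrI (x r))
  refine image_norm_le_of_norm_deriv_right_lt_deriv_boundary' (f := fun τ => Φ r τ (x r) - x r)
    (f' := fun τ => v τ (Φ r τ (x r))) (B := fun τ => (|C| + 1) * (τ - r))
    (B' := fun _ => |C| + 1)
    ((htraj.continuousOn.mono (Icc_subset_Icc_right hr')).sub continuousOn_const)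
    (fun τ hτ => (((htraj τ ⟨hτ.1, hτ.2.le.trans hr'⟩).sub_const _).Ici_of_Icc
      ⟨hτ.1, hτ.2.trans_le hr'⟩)) (by simp [hΦ.refl r hrI]) (by fun_prop)
    (fun τ _ => by
      simpa using (((hasDerivAt_id τ).sub_const r).const_mul (|C| + 1)).hasDerivWithinAt)
    (fun τ hτ hB => ?_) (right_mem_Icc.2 hrr')
  have h1 : ‖Φ r τ (x r) - x r‖ ≤ 1 := by
    rw [hB]
    refine le_trans ?_ hsmall
    gcongr
    exact hτ.2.le
  have h2 : ‖Φ r τ (x r)‖ ≤ R + 1 := by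
    calc ‖Φ r τ (x r)‖ = ‖x r + (Φ r τ (x r) - x r)‖ := by rw [add_sub_cancel]
      _ ≤ ‖x r‖ + ‖Φ r τ (x r) - x r‖ := norm_add_le _ _
      _ ≤ R + 1 := add_le_add (hR r hrI) h1
  calc ‖v τ (Φ r τ (x r))‖ ≤ C :=
        hC (τ, _) ⟨⟨hr.trans hτ.1, hτ.2.le.trans hr'⟩, mem_closedBall_zero_iff.2 h2⟩
    _ ≤ |C| := le_abs_self C
    _ < |C| + 1 := lt_add_one _

/-- Along a continuous curve `x`, the endpoint of the learned trajectory started from `x r` at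
time `r` depends continuously on `r`. -/
lemma IsFlow.continuousOn_restart (hM : IsUniformMetric M lo hi) (hv : IsSmoothField v)
    (ha : ContractsAtRate M v a) (hΦ : IsFlow v Φ) {x : ℝ → E n}
    (hx : ContinuousOn x (Icc 0 1)) : ContinuousOn (fun r => Φ r 1 (x r)) (Icc 0 1) := by
  obtain ⟨C, hC, hspeed⟩ := hΦ.exists_norm_sub_le hv hx
  have hκ : 0 ≤ kappa lo hi := Real.sqrt_nonneg _
  have hle : ∀ r r', 0 ≤ r → r ≤ r' → r' ≤ 1 → C * (r' - r) ≤ 1 →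
      ‖Φ r' 1 (x r') - Φ r 1 (x r)‖ ≤
        kappa lo hi * Real.exp |a| * (‖x r' - x r‖ + C * |r' - r|) := by
    intro r r' hr hrr' hr' hsmall
    have hexp : a * (1 - r') ≤ |a| :=
      calc a * (1 - r') ≤ |a| * (1 - r') :=
            mul_le_mul_of_nonneg_right (le_abs_self _) (sub_nonneg.2 hr')
        _ ≤ |a| * 1 := mul_le_mul_of_nonneg_left (by linarith) (abs_nonneg _)
        _ = |a| := mul_one _
    have hdef : ‖x r' - Φ r r' (x r)‖ ≤ ‖x r' - x r‖ + C * |r' - r| := by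
      calc ‖x r' - Φ r r' (x r)‖ ≤ ‖x r' - x r‖ + ‖x r - Φ r r' (x r)‖ :=
            norm_sub_le_norm_sub_add_norm_sub _ _ _
        _ ≤ _ := by
          rw [norm_sub_rev (x r), abs_of_nonneg (sub_nonneg.2 hrr')]
          gcongr
          exact hspeed r r' hr hrr' hr' hsmall
    calc _ ≤ _ := hΦ.norm_restart_sub_le hM hv ha hr hrr' hr' x
      _ ≤ _ := by gcongr
  intro r hr
  refine tendsto_iff_norm_sub_tendsto_zero.2 (squeeze_zero'
    (g := fun z => kappa lo hi * Real.exp |a| * (‖x z - x r‖ + C * |z - r|))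
    (Eventually.of_forall fun _ => norm_nonneg _) ?_ ?_)
  · have hnear : ∀ᶠ z in 𝓝[Icc 0 1] r, |z - r| < C⁻¹ := by
      exact nhdsWithin_le_nhds (Metric.ball_mem_nhds r (inv_pos.2 hC))
    filter_upwards [self_mem_nhdsWithin, hnear] with z hz hzr
    have hsmall : C * |z - r| ≤ 1 := by
      calc C * |z - r| ≤ C * C⁻¹ := by gcongr
        _ = 1 := mul_inv_cancel₀ hC.ne'
    rcases le_total r z with h | h
    · exact hle r z hr.1 h hz.2 (by rwa [abs_of_nonneg (sub_nonneg.2 h)] at hsmall)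
    · rw [norm_sub_rev, norm_sub_rev (x z), abs_sub_comm]
      exact hle z r hz.1 h hr.2 (by rwa [abs_sub_comm, abs_of_nonneg (sub_nonneg.2 h)] at hsmall)
  · have hxr : Tendsto (fun z => ‖x z - x r‖) (𝓝[Icc 0 1] r) (𝓝 0) :=
      tendsto_iff_norm_sub_tendsto_zero.1 (hx r hr)
    have hid : Tendsto (fun z => C * |z - r|) (𝓝[Icc 0 1] r) (𝓝 0) := by
      have : Continuous fun z => C * |z - r| := by fun_prop
      simpa using (this.tendsto r).mono_left nhdsWithin_le_nhds
    simpa using (hxr.add hid).const_mul (kappa lo hi * Real.exp |a|)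

/-- The bias of the learned flow along one exact trajectory: the endpoint of the restarted learned
trajectory moves, per unit of restart time, by at most the field error `d` propagated to time `1`.
-/
lemma IsFlow.norm_sub_le_terminalBias (hM : IsUniformMetric M lo hi) (hv : IsSmoothField v)
    (ha : ContractsAtRate M v a) (hΦ : IsFlow v Φ) {b : ℝ → E n → E n} {d : ℝ}
    (hd : ∀ τ ∈ Icc (0 : ℝ) 1, ∀ y, ‖b τ y - v τ y‖ ≤ d) {x : ℝ → E n}
    (hx : IsTrajectory b 0 x) :
    ‖x 1 - Φ 0 1 (x 0)‖ ≤ terminalBias (kappa lo hi) d a := by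
  have hκ : 0 < kappa lo hi := Real.sqrt_pos.2 (div_pos hM.hi_pos hM.lo_pos)
  have hexp : Continuous fun r => Real.exp (a * (1 - r)) := by fun_prop
  have hB : ∀ r, HasDerivAt
      (fun r => kappa lo hi * d * ∫ s in (0 : ℝ)..r, Real.exp (a * (1 - s)))
      (kappa lo hi * d * Real.exp (a * (1 - r))) r := fun r =>
    (hexp.integral_hasStrictDerivAt 0 r).hasDerivAt.const_mul _
  have h := norm_sub_le_of_right_slope_le (g := fun r => Φ r 1 (x r)) zero_le_one
    (hΦ.continuousOn_restart hM hv ha hx.continuousOn)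
    (fun r _ => (hB r).continuousAt.continuousWithinAt) (fun r _ => (hB r).hasDerivWithinAt)
    (fun r hr c hc => ?_)
  · simpa [hΦ.refl 1 (right_mem_Icc.2 zero_le_one), terminalBias] using h
  have hrI := Ico_subset_Icc_self hr
  set K := kappa lo hi * Real.exp (a * (1 - r)) with hK
  have hK0 : 0 < K := by positivity
  -- `c₁` splits the slack in `K * d < c` between the local defect and the propagation factor
  obtain ⟨c₁, hdc₁, hc₁⟩ : ∃ c₁, d < c₁ ∧ c₁ < c / K :=
    exists_between ((lt_div_iff₀ hK0).2 (by rw [hK]; linarith))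
  have hfac : ∀ᶠ z in 𝓝[>] r, kappa lo hi * Real.exp (a * (1 - z)) * c₁ < c := by
    have hcont : Continuous fun z => kappa lo hi * Real.exp (a * (1 - z)) * c₁ := by fun_prop
    refine (hcont.tendsto r).mono_left nhdsWithin_le_nhds |>.eventually_lt_const ?_
    rw [lt_div_iff₀ hK0] at hc₁
    rw [← hK]; linarith
  have hdiff : HasDerivWithinAt (fun z => x z - Φ r z (x r)) (b r (x r) - v r (x r))
      (Ici r) r := by
    have h2 := (hΦ.isTrajectory hrI (x r) r ⟨le_rfl, hr.2.le⟩).Ici_of_Icc ⟨le_rfl, hr.2⟩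
    simp only [hΦ.refl r hrI] at h2
    exact ((hx r hrI).Ici_of_Icc hr).fun_sub h2
  have hdef := (hdiff.limsup_norm_slope_le ((hd r hrI _).trans_lt hdc₁)).filter_mono
    (nhdsWithin_mono r Ioi_subset_Ici_self)
  filter_upwards [hfac, hdef, Ioc_mem_nhdsGT hr.2] with z hz1 hz2 hz3
  have hz0 : 0 < z - r := sub_pos.2 hz3.1
  rw [hΦ.refl r hrI, sub_self, sub_zero, Real.norm_of_nonneg hz0.le, inv_mul_lt_iff₀ hz0] at hz2
  calc ‖Φ z 1 (x z) - Φ r 1 (x r)‖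
      ≤ kappa lo hi * Real.exp (a * (1 - z)) * ‖x z - Φ r z (x r)‖ :=
        hΦ.norm_restart_sub_le hM hv ha hr.1 hz3.1.le hz3.2 x
    _ ≤ kappa lo hi * Real.exp (a * (1 - z)) * ((z - r) * c₁) := by gcongr
    _ = kappa lo hi * Real.exp (a * (1 - z)) * c₁ * (z - r) := by ring
    _ ≤ c * (z - r) := by gcongr

end Flow

/-! ### The Wasserstein distance -/

lemma isProbabilityMeasure_of_mem_couplings {μ ν : Measure (E n)} [IsProbabilityMeasure μ]
    {π : Measure (E n × E n)} (hπ : π ∈ couplings μ ν) : IsProbabilityMeasure π := by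
  constructor
  rw [← measure_univ (μ := μ), ← hπ.1, Measure.map_apply measurable_fst MeasurableSet.univ,
    preimage_univ]

lemma W2_eq_iInf_eLpNorm (μ ν : Measure (E n)) :
    W2 μ ν = ⨅ π : couplings μ ν, eLpNorm (fun z : E n × E n => z.1 - z.2) 2 π.1 := by
  have h := (ENNReal.orderIsoRpow (1 / 2 : ℝ) (by norm_num)).map_iInf
    fun π : couplings μ ν => ∫⁻ z, ‖z.1 - z.2‖ₑ ^ 2 ∂π.1
  simp only [ENNReal.orderIsoRpow_apply] at h
  rw [W2, iInf_subtype', h]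
  refine iInf_congr fun π => ?_
  rw [eLpNorm_eq_lintegral_rpow_enorm_toReal (by norm_num) (by norm_num)]
  simp

lemma W2_le_eLpNorm {μ ν : Measure (E n)} {Ω : Type*} [MeasurableSpace Ω] {P : Measure Ω}
    {X Y : Ω → E n} (hX : Measurable X) (hY : Measurable Y) (hμ : P.map X = μ) (hν : P.map Y = ν) :
    W2 μ ν ≤ eLpNorm (fun ω => X ω - Y ω) 2 P := by
  have hXY : Measurable fun ω => (X ω, Y ω) := hX.prodMk hY
  have hmem : P.map (fun ω => (X ω, Y ω)) ∈ couplings μ ν :=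
    ⟨by rw [Measure.map_map measurable_fst hXY]; exact hμ,
      by rw [Measure.map_map measurable_snd hXY]; exact hν⟩
  rw [W2_eq_iInf_eLpNorm]
  refine (iInf_le _ (⟨_, hmem⟩ : couplings μ ν)).trans_eq ?_
  rw [eLpNorm_map_measure (by fun_prop) hXY.aemeasurable]
  rfl

/-- Gluing: two couplings with a common marginal `ν` are the two-dimensional marginals of one
measure, under which the outer coordinates are conditionally independent given the middle one. -/
lemma exists_gluing {μ ν ξ : Measure (E n)} [IsProbabilityMeasure ν]
    {π₁ π₂ : Measure (E n × E n)} (h₁ : π₁ ∈ couplings μ ν) (h₂ : π₂ ∈ couplings ν ξ) :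
    ∃ γ : Measure (E n × E n × E n),
      γ.map (fun z => (z.2.1, z.1)) = π₁ ∧ γ.map (fun z => (z.1, z.2.2)) = π₂ := by
  have hπ₂ : IsProbabilityMeasure π₂ := isProbabilityMeasure_of_mem_couplings h₂
  have hswap : π₁.map Prod.swap ∈ couplings ν μ :=
    ⟨by rw [Measure.map_map measurable_fst measurable_swap]; exact h₁.2,
      by rw [Measure.map_map measurable_snd measurable_swap]; exact h₁.1⟩
  have hπ₁ : IsProbabilityMeasure (π₁.map Prod.swap) :=
    isProbabilityMeasure_of_mem_couplings hswap
  have hd₁ : ν ⊗ₘ (π₁.map Prod.swap).condKernel = π₁.map Prod.swap := by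
    conv_rhs => rw [← (π₁.map Prod.swap).disintegrate (π₁.map Prod.swap).condKernel]
    rw [Measure.fst, hswap.1]
  have hd₂ : ν ⊗ₘ π₂.condKernel = π₂ := by
    conv_rhs => rw [← π₂.disintegrate π₂.condKernel]
    rw [Measure.fst, h₂.1]
  set κ₁ := (π₁.map Prod.swap).condKernel
  set κ₂ := π₂.condKernel
  refine ⟨ν ⊗ₘ (κ₁ ×ₖ κ₂), ?_, ?_⟩
  · have h : (ν ⊗ₘ (κ₁ ×ₖ κ₂)).map (Prod.map id Prod.fst) = π₁.map Prod.swap := by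
      rw [← Measure.compProd_map measurable_fst, ← Kernel.fst_eq, Kernel.fst_prod, hd₁]
    calc (ν ⊗ₘ (κ₁ ×ₖ κ₂)).map (fun z => (z.2.1, z.1))
        = ((ν ⊗ₘ (κ₁ ×ₖ κ₂)).map (Prod.map id Prod.fst)).map Prod.swap := by
          rw [Measure.map_map measurable_swap (by fun_prop)]; rfl
      _ = π₁ := by
          rw [h, Measure.map_map measurable_swap measurable_swap, Prod.swap_swap_eq,
            Measure.map_id]
  · have h : (ν ⊗ₘ (κ₁ ×ₖ κ₂)).map (Prod.map id Prod.snd) = π₂ := by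
      rw [← Measure.compProd_map measurable_snd, ← Kernel.snd_eq, Kernel.snd_prod, hd₂]
    exact h

lemma W2_triangle {μ ν ξ : Measure (E n)} [IsProbabilityMeasure ν] :
    W2 μ ξ ≤ W2 μ ν + W2 ν ξ := by
  rw [W2_eq_iInf_eLpNorm μ ν, W2_eq_iInf_eLpNorm ν ξ, ENNReal.iInf_add]
  refine le_iInf fun π₁ => ?_
  rw [ENNReal.add_iInf]
  refine le_iInf fun π₂ => ?_
  obtain ⟨γ, hγ₁, hγ₂⟩ := exists_gluing π₁.2 π₂.2
  have hm₁ : Measurable fun z : E n × E n × E n => (z.2.1, z.1) := by fun_prop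
  have hm₂ : Measurable fun z : E n × E n × E n => (z.1, z.2.2) := by fun_prop
  have hμ : γ.map (fun z => z.2.1) = μ := by
    rw [← π₁.2.1, ← hγ₁, Measure.map_map measurable_fst hm₁]; rfl
  have hξ : γ.map (fun z => z.2.2) = ξ := by
    rw [← π₂.2.2, ← hγ₂, Measure.map_map measurable_snd hm₂]; rfl
  have h := eLpNorm_add_le (μ := γ) (p := 2) (f := fun z => z.2.1 - z.1) (g := fun z => z.1 - z.2.2)
    (by fun_prop) (by fun_prop) (by norm_num)
  rw [← hγ₁, ← hγ₂, eLpNorm_map_measure (by fun_prop) hm₁.aemeasurable,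
    eLpNorm_map_measure (by fun_prop) hm₂.aemeasurable]
  refine (W2_le_eLpNorm (by fun_prop) (by fun_prop) hμ hξ).trans (le_trans (le_of_eq ?_) h)
  congr 1
  ext1 z
  simp

lemma W2_map_le {μ ν : Measure (E n)} [IsProbabilityMeasure μ] {S T : E n → E n}
    (hS : Measurable S) (hT : Measurable T) {L δ : ℝ} (hL : 0 < L) (hδ : 0 ≤ δ)
    (h : ∀ x y, ‖S x - T y‖ ≤ L * ‖x - y‖ + δ) :
    W2 (μ.map S) (ν.map T) ≤ ENNReal.ofReal L * W2 μ ν + ENNReal.ofReal δ := by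
  rw [W2_eq_iInf_eLpNorm μ ν,
    ENNReal.mul_iInf_of_ne (ENNReal.ofReal_pos.2 hL).ne' ENNReal.ofReal_ne_top, ENNReal.iInf_add]
  refine le_iInf fun π => ?_
  have hπ : IsProbabilityMeasure π.1 := isProbabilityMeasure_of_mem_couplings π.2
  have h1 : W2 (μ.map S) (ν.map T) ≤ eLpNorm (fun z => S z.1 - T z.2) 2 π.1 := by
    refine W2_le_eLpNorm (by fun_prop) (by fun_prop) ?_ ?_
    · conv_rhs => rw [← π.2.1, Measure.map_map hS measurable_fst]
      rfl
    · conv_rhs => rw [← π.2.2, Measure.map_map hT measurable_snd]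
      rfl
  calc W2 (μ.map S) (ν.map T) ≤ eLpNorm (fun z => S z.1 - T z.2) 2 π.1 := h1
    _ ≤ eLpNorm ((fun z : E n × E n => L * ‖z.1 - z.2‖) + fun _ => δ) 2 π.1 :=
      eLpNorm_mono_real fun z => h z.1 z.2
    _ ≤ eLpNorm (fun z : E n × E n => L * ‖z.1 - z.2‖) 2 π.1 +
        eLpNorm (fun _ : E n × E n => δ) 2 π.1 :=
      eLpNorm_add_le (by fun_prop) (by fun_prop) (by norm_num)
    _ ≤ _ := by
      refine add_le_add (eLpNorm_le_mul_eLpNorm_of_ae_le_mul (.of_forall fun z => ?_) 2) ?_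
      · simp [abs_of_pos hL]
      · rw [eLpNorm_const' _ (by norm_num) (by norm_num)]
        simp [Real.enorm_of_nonneg hδ]

/-- The pathwise comparison of the two flows, integrated against couplings of the filtered laws. -/
lemma W2_perronFrobenius_le {v b : ℝ → E n → E n} {Φ ΦL : ℝ → ℝ → E n → E n} {a : ℝ}
    (hM : IsUniformMetric M lo hi) (hv : IsSmoothField v) (ha : ContractsAtRate M v a)
    (hΦ : IsFlow b Φ) (hΦL : IsFlow v ΦL) (herr : BddAbove (Set.range (fieldError b v)))
    {ρ ρ' : Measure (E n)} [IsProbabilityMeasure ρ] :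
    W2 (perronFrobenius Φ ρ) (perronFrobenius ΦL ρ') ≤
      ENNReal.ofReal (kappa lo hi * Real.exp a) * W2 ρ ρ' +
        ENNReal.ofReal (terminalBias (kappa lo hi) (dBar b v) a) := by
  have h0 : (0 : ℝ) ∈ Icc (0 : ℝ) 1 := left_mem_Icc.2 zero_le_one
  have h1 : (1 : ℝ) ∈ Icc (0 : ℝ) 1 := right_mem_Icc.2 zero_le_one
  have hκ : 0 < kappa lo hi := Real.sqrt_pos.2 (div_pos hM.hi_pos hM.lo_pos)
  have hd : ∀ τ ∈ Icc (0 : ℝ) 1, ∀ y, ‖b τ y - v τ y‖ ≤ dBar b v := fun τ hτ y =>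
    le_ciSup herr (y, (⟨τ, hτ⟩ : Icc (0 : ℝ) 1))
  have hbias : ∀ x, ‖Φ 0 1 x - ΦL 0 1 x‖ ≤ terminalBias (kappa lo hi) (dBar b v) a := fun x => by
    simpa only [hΦ.refl 0 h0] using
      hΦL.norm_sub_le_terminalBias hM hv ha hd (hΦ.isTrajectory h0 x)
  refine W2_map_le (hΦ.measurable 0 h0 1 h1) (hΦL.measurable 0 h0 1 h1) (by positivity)
    ((norm_nonneg _).trans (hbias 0)) fun x y => ?_
  have hlip := hΦL.norm_sub_le hM hv ha h0 y x
  rw [sub_zero, mul_one] at hlip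
  calc ‖Φ 0 1 x - ΦL 0 1 y‖ ≤ ‖Φ 0 1 x - ΦL 0 1 x‖ + ‖ΦL 0 1 x - ΦL 0 1 y‖ :=
        norm_sub_le_norm_sub_add_norm_sub _ _ _
    _ ≤ _ := by linarith [hbias x]

end FaultRecovery

open FaultRecovery in
theorem mainTheorem6 {n m p q : ℕ}
    -- the fault-indexed stochastic system and its initial law
    (S : FaultSystem n m p q) (μ₀ : Measure (E n)) (hμ₀ : IsP2 μ₀)
    -- the endpoints `s = t_k` and `e = t_{k + Nr}` of the recovery horizon
    (t : ℕ → ℝ≥0) (ht : StrictMono t) (k Nr : ℕ) (hNr : 0 < Nr)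
    (s e : ℝ≥0) (hs : s = t k) (he : e = t (k + Nr))
    -- the true fault and the identified fault
    (wStar wHat : Profile p) (hw : wStar = wHat) (hreg : S.IsRegular wStar)
    -- exact fields and flows, indexed by the fault and the physical endpoints
    (b : Profile p → ℝ≥0 → ℝ≥0 → ℝ → E n → E n)
    (Φ : Profile p → ℝ≥0 → ℝ≥0 → ℝ → ℝ → E n → E n)
    (hb : S.IsExactField wStar μ₀ s e (b wStar s e))
    (hΦ : IsFlow (b wStar s e) (Φ wStar s e))
    -- learned flow maps and the velocity fields they induce
    (bL : Profile p → ℝ≥0 → ℝ≥0 → ℝ → E n → E n)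
    (ΦL : Profile p → ℝ≥0 → ℝ≥0 → ℝ → ℝ → E n → E n)
    (hbL : IsSmoothField (bL wStar s e))
    (hΦL : IsFlow (bL wStar s e) (ΦL wStar s e))
    -- the contraction certificate: metric, rate and metric bounds for each fault
    (M : Profile p → E n → ℝ → Matrix (Fin n) (Fin n) ℝ) (α lo hi : Profile p → ℝ)
    (hM : IsUniformMetric (M wStar) (lo wStar) (hi wStar))
    (hres : BddAbove (Set.range (residualSize (M wStar) (α wStar) (bL wStar s e))))
    (herr : BddAbove (Set.range (fieldError (b wStar s e) (bL wStar s e))))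
    -- the true and the estimated filtered law, and the mixture surrogate
    (ρ ρHat : Measure (E n)) (hρ : IsP2 ρ) (hρHat : IsP2 ρHat)
    (ρGMM : Measure (E n)) (hGMM : IsGaussianMixture ρGMM)
    (εf : ℝ) (hεf : 0 < εf)
    (happrox : W2 (perronFrobenius (ΦL wHat s e) ρHat) ρGMM ≤ ENNReal.ofReal εf) :
    W2 (perronFrobenius (Φ wStar s e) ρ) ρGMM ≤
        ENNReal.ofReal (kappa (lo wStar) (hi wStar) *
            Real.exp (correctedRate (M wStar) (α wStar) (lo wStar) (bL wStar s e))) * W2 ρ ρHat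
          + ENNReal.ofReal (terminalBias (kappa (lo wStar) (hi wStar))
              (dBar (b wStar s e) (bL wStar s e))
              (correctedRate (M wStar) (α wStar) (lo wStar) (bL wStar s e)))
          + ENNReal.ofReal εf ∧
      -- for an exact certificate the corrected rate is the certified rate
      (epsCtr (M wStar) (α wStar) (bL wStar s e) = 0 →
        W2 (perronFrobenius (Φ wStar s e) ρ) ρGMM ≤
          ENNReal.ofReal (kappa (lo wStar) (hi wStar) * Real.exp (α wStar)) * W2 ρ ρHat
            + ENNReal.ofReal (terminalBias (kappa (lo wStar) (hi wStar))
                (dBar (b wStar s e) (bL wStar s e)) (α wStar))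
            + ENNReal.ofReal εf) := by
  subst hw
  have := hρ.prob
  have := hρHat.prob
  have : IsProbabilityMeasure (perronFrobenius (ΦL wStar s e) ρHat) :=
    Measure.isProbabilityMeasure_map
      (hΦL.measurable 0 (left_mem_Icc.2 zero_le_one) 1 (right_mem_Icc.2 zero_le_one)).aemeasurable
  have hbound : W2 (perronFrobenius (Φ wStar s e) ρ) ρGMM ≤
      ENNReal.ofReal (kappa (lo wStar) (hi wStar) *
          Real.exp (correctedRate (M wStar) (α wStar) (lo wStar) (bL wStar s e))) * W2 ρ ρHat
        + ENNReal.ofReal (terminalBias (kappa (lo wStar) (hi wStar))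
            (dBar (b wStar s e) (bL wStar s e))
            (correctedRate (M wStar) (α wStar) (lo wStar) (bL wStar s e)))
        + ENNReal.ofReal εf :=
    W2_triangle.trans (add_le_add (W2_perronFrobenius_le hM hbL
      (contractsAtRate_correctedRate hM hres) hΦ hΦL herr) happrox)
  refine ⟨hbound, fun hε => ?_⟩
  simpa only [correctedRate, hε, zero_div, add_zero] using hbound
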